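/- For integers $n\ge 1$, $k_1,\dots,k_n\ge 1$ with $k_n\ge 2$, let $$\zeta^{\star}(k_1,\dots,k_n)=\sum_{0<m_1\le m_2\le\cdots\le m_n}\frac{1}{m_1^{k_1}\cdots m_n^{k_n}}$$ be the multiple zeta-star value, the sum running over all integers $m_1,\dots,m_n$ with $0<m_1\le\cdots\le m_n$. Then for all integers $r\ge 0$ and $s\ge 2$, $$\zeta^{\star}(\underbrace{1,\ldots,1}_{r+1},\underbrace{2,\ldots,2}_{s-1})=\sum_{i=0}^{r}(-1)^{r-i}\,2^{i+1}\sum_{\substack{k_1+\cdots+k_{i+1}=r+1\\ k_j\in\mathbb{Z}_{\ge 1}}}\zeta^{\star}(k_1,\ldots,k_i,\,k_{i+1}+2s-2),$$ where all the multiple series that occur converge. (This identity is the Ohno–Zudilin two-one formula for the indices consisting of $r+1$ ones followed by $s-1$ twos.) -/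

import Mathlib

/-- The tuples `(m_1, …, m_n)` of integers with `0 < m_1 ≤ ⋯ ≤ m_n`. -/
def StarTuple (n : ℕ) : Type := {m : Fin n → ℕ // (∀ j, 0 < m j) ∧ Monotone m}

/-- The term `1 / (m_1 ^ k_1 ⋯ m_n ^ k_n)` of the series of the multiple zeta-star value. -/
noncomputable def zetaStarTerm {n : ℕ} (k : Fin n → ℕ) (m : StarTuple n) : ℝ :=
  1 / ∏ j, ((m.1 j : ℕ) : ℝ) ^ k j

/-- The multiple zeta-star value
`ζ⋆(k_1, …, k_n) = ∑_{0 < m_1 ≤ ⋯ ≤ m_n} 1 / (m_1 ^ k_1 ⋯ m_n ^ k_n)`. -/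
noncomputable def zetaStar {n : ℕ} (k : Fin n → ℕ) : ℝ :=
  ∑' m : StarTuple n, zetaStarTerm k m

/-- The index `(1, …, 1, 2, …, 2)` with `a` ones followed by `b` twos. -/
def onesTwos (a b : ℕ) : Fin (a + b) → ℕ :=
  Fin.append (fun _ : Fin a => 1) (fun _ : Fin b => 2)

/-- The tuples `(k_1, …, k_n)` of integers `k_j ≥ 1` with `k_1 + ⋯ + k_n = w`. -/
def positiveTuples (n w : ℕ) : Finset (Fin n → ℕ) :=
  (Finset.Nat.antidiagonalTuple n w).filter (fun k => ∀ j, 1 ≤ k j)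

/-- The index `(k_1, …, k_i, k_{i+1} + c)`. -/
def addToLast {i : ℕ} (k : Fin (i + 1) → ℕ) (c : ℕ) : Fin (i + 1) → ℕ :=
  Function.update k (Fin.last i) (k (Fin.last i) + c)

/-!
The identity is the limit `N → ∞` of an identity between finite sums. Write `starSum k N` for the
sum of the terms of `ζ⋆(k)` over the tuples bounded by `N`, and put
`w_N(m) = binom(N, m) / binom(N + m, m)` (`binomWeight`), so that `w_N(m) → 1` as `N → ∞`.

* Since `w_N(m) - w_{N-1}(m) = w_N(m) m² / N²`, whenever `starSum k N = ∑_m w_N(m) a_m` holds for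
  all `N`, appending a `2` to `k` replaces `a_m` by `a_m / m²` (`starSum_onesTwos`). This reduces the
  finite identity to the index `(1, …, 1)`.
* For that index one compares generating functions in the length `w` of the index. On the left one
  gets `∏_{j ≤ N} (1 - x / j)⁻¹`. On the right, a block of exponent `l` carries the sign and power of
  two `2 (-1)^(l-1) (x / m)^l`, summing to `2x / (m + x)`, so that one gets
  `1 + ∑_m w_N(m) (P_m - P_{m-1})` with `P_m = ∏_{j ≤ m} (j + x) / (j - x)`. The two sides satisfy
  the same recursion in `N`, by a telescoping sum in `m` (`telescoping_signedTerm`). The proof below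
  works with the coefficients: `signedSum m w` is the coefficient of `x ^ w` in `P_m`, and
  `signedTerm m w` the one in `P_m - P_{m-1}`.

Convergence follows from `starSum k N ≤ 2 ^ n √N`, and the passage to the limit on the right-hand
side is dominated convergence, as `0 ≤ w_N(m) ≤ 1`.
-/

open Finset Filter Topology

/-! ### Truncated zeta-star sums -/

/-- The truncated sum `∑_{0 < m_1 ≤ ⋯ ≤ m_n ≤ N} 1 / (m_1 ^ k_1 ⋯ m_n ^ k_n)`, defined by summing
over the largest variable last. -/
noncomputable def starSum : {n : ℕ} → (Fin n → ℕ) → ℕ → ℝ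
  | 0, _, _ => 1
  | n + 1, k, N => ∑ m ∈ range N, starSum (Fin.init k) (m + 1) / ((m + 1 : ℕ) : ℝ) ^ k (Fin.last n)

/-- The part of the zeta-star series in which the largest variable equals `m`. -/
noncomputable def starTerm {n : ℕ} (k : Fin (n + 1) → ℕ) (m : ℕ) : ℝ :=
  starSum (Fin.init k) m / (m : ℝ) ^ k (Fin.last n)

theorem starSum_zero (k : Fin 0 → ℕ) (N : ℕ) : starSum k N = 1 := by
  simp [starSum]

theorem starSum_succ {n : ℕ} (k : Fin (n + 1) → ℕ) (N : ℕ) :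
    starSum k N = ∑ m ∈ range N, starTerm k (m + 1) := by
  simp [starSum, starTerm]

theorem starSum_nonneg {n : ℕ} (k : Fin n → ℕ) (N : ℕ) : 0 ≤ starSum k N := by
  induction n generalizing N with
  | zero => simp [starSum]
  | succ n ih =>
    rw [starSum]
    exact sum_nonneg fun m _ => div_nonneg (ih _ _) (by positivity)

theorem starTerm_nonneg {n : ℕ} (k : Fin (n + 1) → ℕ) (m : ℕ) : 0 ≤ starTerm k m :=
  div_nonneg (starSum_nonneg _ _) (by positivity)

open Classical in
/-- The monotone tuples of positive integers bounded by `N`. -/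
noncomputable def boundedTuples (n N : ℕ) : Finset (Fin n → ℕ) :=
  (Fintype.piFinset fun _ => Icc 1 N).filter Monotone

theorem mem_boundedTuples {n N : ℕ} {m : Fin n → ℕ} :
    m ∈ boundedTuples n N ↔ (∀ j, 1 ≤ m j ∧ m j ≤ N) ∧ Monotone m := by
  simp [boundedTuples]

theorem starSum_eq_sum_boundedTuples {n : ℕ} (k : Fin n → ℕ) (N : ℕ) :
    starSum k N = ∑ m ∈ boundedTuples n N, 1 / ∏ j, ((m j : ℕ) : ℝ) ^ k j := by
  induction n generalizing N with
  | zero =>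
    have : boundedTuples 0 N = {Fin.elim0} := by
      ext m
      simp [mem_boundedTuples, Subsingleton.elim m Fin.elim0, Subsingleton.monotone]
    simp [starSum, this]
  | succ n ih =>
    simp only [starSum, ih, sum_div, sum_sigma']
    refine sum_bij' (fun p _ => Fin.snoc p.2 (p.1 + 1))
      (fun m _ => ⟨m (Fin.last n) - 1, Fin.init m⟩) ?_ ?_ ?_ ?_ ?_
    · rintro ⟨a, m⟩ h
      simp only [mem_sigma, mem_range, mem_boundedTuples] at h ⊢
      obtain ⟨ha, hm, hmono⟩ := h
      refine ⟨fun j => ?_, fun i j hij => ?_⟩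
      · refine Fin.lastCases ?_ (fun j => ?_) j
        · simp; omega
        · have := hm j
          simp only [Fin.snoc_castSucc]; omega
      · revert hij
        refine Fin.lastCases ?_ (fun j => ?_) j
        · intro _
          refine Fin.lastCases ?_ (fun i => ?_) i
          · simp
          · simpa using (hm i).2
        · refine Fin.lastCases ?_ (fun i => ?_) i
          · intro h
            exact absurd h (not_le.2 (Fin.castSucc_lt_last j))
          · intro h
            simpa using hmono (Fin.castSucc_le_castSucc_iff.1 h)
    · intro m h
      rw [mem_boundedTuples] at h
      obtain ⟨hm, hmono⟩ := h
      simp only [mem_sigma, mem_range, mem_boundedTuples]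
      have h1 := hm (Fin.last n)
      refine ⟨by omega, fun j => ⟨(hm j.castSucc).1, ?_⟩, fun i j hij => ?_⟩
      · have := hmono (Fin.le_last j.castSucc)
        simp only [Fin.init]; omega
      · exact hmono (Fin.castSucc_le_castSucc_iff.2 hij)
    · rintro ⟨a, m⟩ h
      simp
    · intro m h
      rw [mem_boundedTuples] at h
      have h1 := (h.1 (Fin.last n)).1
      simp only [Nat.sub_add_cancel h1, Fin.snoc_init_self]
    · rintro ⟨a, m⟩ h
      rw [Fin.prod_univ_castSucc]
      simp [Fin.init, div_eq_mul_inv, mul_comm]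

/-! ### Convergence -/

theorem sum_one_div_sqrt_le (N : ℕ) :
    ∑ m ∈ range N, 1 / √((m + 1 : ℕ) : ℝ) ≤ 2 * √(N : ℝ) := by
  induction N with
  | zero => simp
  | succ N ih =>
    rw [sum_range_succ]
    set a := √(N : ℝ)
    set b := √((N + 1 : ℕ) : ℝ)
    have hb : 0 < b := Real.sqrt_pos.2 (by positivity)
    have ha2 : a ^ 2 = N := Real.sq_sqrt (by positivity)
    have hb2 : b ^ 2 = N + 1 := by
      rw [Real.sq_sqrt (by positivity)]; push_cast; ring
    have key : 1 / b ≤ 2 * (b - a) := by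
      rw [div_le_iff₀ hb]
      nlinarith [sq_nonneg (a - b)]
    linarith

theorem starSum_le_sqrt {n : ℕ} (k : Fin n → ℕ) (hk : ∀ j, 1 ≤ k j) (N : ℕ) (hN : 1 ≤ N) :
    starSum k N ≤ 2 ^ n * √(N : ℝ) := by
  induction n generalizing N with
  | zero =>
    rw [starSum_zero, pow_zero, one_mul, Real.one_le_sqrt]
    exact_mod_cast hN
  | succ n ih =>
    have hterm : ∀ m ∈ range N, starSum (Fin.init k) (m + 1) / ((m + 1 : ℕ) : ℝ) ^ k (Fin.last n) ≤
        2 ^ n * (1 / √((m + 1 : ℕ) : ℝ)) := by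
      intro m _
      have h1 : (1 : ℝ) ≤ ((m + 1 : ℕ) : ℝ) := by push_cast; linarith [m.cast_nonneg (α := ℝ)]
      have h2 : ((m + 1 : ℕ) : ℝ) ≤ ((m + 1 : ℕ) : ℝ) ^ k (Fin.last n) :=
        le_self_pow₀ h1 (by have := hk (Fin.last n); omega)
      calc starSum (Fin.init k) (m + 1) / ((m + 1 : ℕ) : ℝ) ^ k (Fin.last n)
          ≤ (2 ^ n * √((m + 1 : ℕ) : ℝ)) / ((m + 1 : ℕ) : ℝ) :=
            div_le_div₀ (by positivity) (ih _ (fun j => hk _) _ (by omega)) (by linarith) h2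
        _ = 2 ^ n * (1 / √((m + 1 : ℕ) : ℝ)) := by
            rw [mul_div_assoc, Real.sqrt_div_self']
    rw [starSum]
    refine (sum_le_sum hterm).trans ?_
    rw [← mul_sum, pow_succ, mul_assoc]
    exact mul_le_mul_of_nonneg_left (sum_one_div_sqrt_le N) (by positivity)

theorem summable_starTerm {n : ℕ} (k : Fin (n + 1) → ℕ) (hk : ∀ j, 1 ≤ k j)
    (hlast : 2 ≤ k (Fin.last n)) : Summable fun m => starTerm k (m + 1) := by
  have hs : Summable fun m : ℕ => 2 ^ n * (1 / (m : ℝ) ^ (3 / 2 : ℝ)) :=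
    (Real.summable_one_div_nat_rpow.2 (by norm_num)).mul_left _
  refine Summable.of_nonneg_of_le (fun m => starTerm_nonneg k _) (fun m => ?_)
    ((summable_nat_add_iff 1).2 hs)
  have h0 : (0 : ℝ) < ((m + 1 : ℕ) : ℝ) := by positivity
  have h1 : (1 : ℝ) ≤ ((m + 1 : ℕ) : ℝ) := by push_cast; linarith [m.cast_nonneg (α := ℝ)]
  have h2 : ((m + 1 : ℕ) : ℝ) ^ 2 ≤ ((m + 1 : ℕ) : ℝ) ^ k (Fin.last n) := pow_le_pow_right₀ h1 hlast
  calc starTerm k (m + 1)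
      ≤ (2 ^ n * √((m + 1 : ℕ) : ℝ)) / ((m + 1 : ℕ) : ℝ) ^ 2 :=
        div_le_div₀ (by positivity) (starSum_le_sqrt _ (fun j => hk _) _ (by omega))
          (by positivity) h2
    _ = 2 ^ n * (1 / ((m + 1 : ℕ) : ℝ) ^ (3 / 2 : ℝ)) := by
        rw [mul_div_assoc, Real.sqrt_eq_rpow, ← Real.rpow_two, ← Real.rpow_sub h0,
          one_div (_ ^ (3 / 2 : ℝ)), ← Real.rpow_neg h0.le]
        norm_num

theorem zetaStarTerm_nonneg {n : ℕ} (k : Fin n → ℕ) (m : StarTuple n) : 0 ≤ zetaStarTerm k m := by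
  unfold zetaStarTerm
  positivity

/-- The truncated sums exhaust the zeta-star series, which thus has the sum `∑_m starTerm k m`. -/
theorem hasSum_zetaStarTerm {n : ℕ} (k : Fin (n + 1) → ℕ) (hk : ∀ j, 1 ≤ k j)
    (hlast : 2 ≤ k (Fin.last n)) :
    HasSum (zetaStarTerm k) (∑' m, starTerm k (m + 1)) := by
  classical
  let T : ℕ → Finset (StarTuple (n + 1)) := fun N =>
    (boundedTuples (n + 1) N).subtype
      (fun m : Fin (n + 1) → ℕ => (∀ j, 0 < m j) ∧ Monotone m)
  have hT : ∀ N, ∑ m ∈ T N, zetaStarTerm k m = starSum k N := by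
    intro N
    rw [starSum_eq_sum_boundedTuples]
    exact sum_subtype_of_mem (fun m : Fin (n + 1) → ℕ => 1 / ∏ j, ((m j : ℕ) : ℝ) ^ k j)
      fun m hm => ⟨fun j => ((mem_boundedTuples.1 hm).1 j).1, (mem_boundedTuples.1 hm).2⟩
  have hmem : ∀ (m : StarTuple (n + 1)) (N : ℕ), m ∈ T N ↔ m.1 (Fin.last n) ≤ N := by
    intro m N
    refine (mem_subtype).trans (mem_boundedTuples.trans ⟨fun h => (h.1 _).2, fun h => ?_⟩)
    exact ⟨fun j => ⟨m.2.1 j, (m.2.2 (Fin.le_last j)).trans h⟩, m.2.2⟩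
  have hmono : Monotone T := fun a b hab m hm => (hmem m b).2 (((hmem m a).1 hm).trans hab)
  have htend : Tendsto T atTop atTop :=
    tendsto_atTop_finset_of_monotone hmono fun m => ⟨_, (hmem m _).2 le_rfl⟩
  have hsum := summable_starTerm k hk hlast
  have hsummable : Summable (zetaStarTerm k) := by
    refine summable_of_sum_le (c := ∑' m, starTerm k (m + 1)) (zetaStarTerm_nonneg k) fun u => ?_
    obtain ⟨N, hN⟩ := (htend.eventually (eventually_ge_atTop u)).exists
    calc ∑ m ∈ u, zetaStarTerm k m ≤ ∑ m ∈ T N, zetaStarTerm k m :=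
          sum_le_sum_of_subset_of_nonneg hN fun m _ _ => zetaStarTerm_nonneg k m
      _ = ∑ m ∈ range N, starTerm k (m + 1) := by rw [hT, starSum_succ]
      _ ≤ _ := hsum.sum_le_tsum _ fun m _ => starTerm_nonneg k _
  have h1 : Tendsto (fun N => starSum k N) atTop (𝓝 (∑' m, zetaStarTerm k m)) := by
    simpa only [Function.comp_def, hT] using hsummable.hasSum.comp htend
  have h2 : Tendsto (fun N => starSum k N) atTop (𝓝 (∑' m, starTerm k (m + 1))) := by
    simpa only [starSum_succ] using hsum.hasSum.tendsto_sum_nat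
  rw [← tendsto_nhds_unique h1 h2]
  exact hsummable.hasSum

/-! ### The binomial weights -/

/-- The weight `binom(N, m) / binom(N + m, m)`, written as a product so that its vanishing for
`N < m` and its limit for `N → ∞` can be read off. -/
noncomputable def binomWeight (N m : ℕ) : ℝ :=
  ∏ j ∈ range m, ((N : ℝ) - j) / (N + j + 1)

theorem binomWeight_zero (N : ℕ) : binomWeight N 0 = 1 := by
  simp [binomWeight]

theorem binomWeight_succ (N m : ℕ) :
    binomWeight N (m + 1) = binomWeight N m * (((N : ℝ) - m) / (N + m + 1)) :=
  prod_range_succ _ _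

theorem binomWeight_succ_mul (N m : ℕ) :
    binomWeight N (m + 1) * (N + m + 1) = binomWeight N m * (N - m) := by
  have : (N : ℝ) + m + 1 ≠ 0 := by positivity
  rw [binomWeight_succ]
  field_simp

theorem binomWeight_eq_zero {N m : ℕ} (h : N < m) : binomWeight N m = 0 :=
  prod_eq_zero (mem_range.2 h) (by simp)

theorem binomWeight_mem_Icc (N m : ℕ) : binomWeight N m ∈ Set.Icc (0 : ℝ) 1 := by
  rcases lt_or_ge N m with h | h
  · simp [binomWeight_eq_zero h]
  · have hj : ∀ j ∈ range m, (0 : ℝ) ≤ N - j := fun j hj => by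
      have : (j : ℝ) ≤ N := by exact_mod_cast (mem_range.1 hj).le.trans h
      linarith
    refine ⟨prod_nonneg fun j hjm => div_nonneg (hj j hjm) (by positivity),
      prod_le_one (fun j hjm => div_nonneg (hj j hjm) (by positivity)) fun j _ => ?_⟩
    rw [div_le_one (by positivity)]
    linarith [j.cast_nonneg (α := ℝ)]

theorem tendsto_binomWeight (m : ℕ) : Tendsto (fun N => binomWeight N m) atTop (𝓝 1) := by
  have h : ∀ j ∈ range m, Tendsto (fun N : ℕ => ((N : ℝ) - j) / (N + j + 1)) atTop (𝓝 1) := by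
    intro j _
    have h0 : Tendsto (fun N : ℕ => 1 - (2 * (j : ℝ) + 1) / ((N : ℝ) + (j + 1))) atTop
        (𝓝 (1 - 0)) :=
      tendsto_const_nhds.sub (tendsto_const_nhds.div_atTop
        (tendsto_atTop_add_const_right _ _ tendsto_natCast_atTop_atTop))
    rw [sub_zero] at h0
    refine h0.congr fun N => ?_
    have : (N : ℝ) + j + 1 ≠ 0 := by positivity
    have : (N : ℝ) + (j + 1) ≠ 0 := by positivity
    field_simp
    ring
  simpa [binomWeight] using tendsto_finsetProd _ h

/-- The recursion in `N`; in the usual form, `w_{N+1}(m) - w_N(m) = w_{N+1}(m) m² / (N + 1)²`. -/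
theorem sq_mul_binomWeight (N m : ℕ) :
    ((N : ℝ) + 1) ^ 2 * binomWeight N m =
      (((N : ℝ) + 1) ^ 2 - m ^ 2) * binomWeight (N + 1) m := by
  induction m with
  | zero => simp [binomWeight_zero]
  | succ m ih =>
    have h1 : (N : ℝ) + m + 1 ≠ 0 := by positivity
    have h2 : (N : ℝ) + 1 + m + 1 ≠ 0 := by positivity
    rw [binomWeight_succ, binomWeight_succ, ← mul_assoc, ih]
    push_cast
    field_simp
    ring

/-- If `b (N + 1) - b N = ∑_m w_{N+1}(m) a_m m² / (N + 1)²`, then `b N = ∑_m w_N(m) a_m`. -/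
theorem eq_sum_binomWeight_mul {a b : ℕ → ℝ} (h0 : b 0 = 0)
    (hb : ∀ N : ℕ, ((N : ℝ) + 1) ^ 2 * (b (N + 1) - b N) =
      ∑ m ∈ range (N + 1), binomWeight (N + 1) (m + 1) * (((m : ℝ) + 1) ^ 2 * a (m + 1))) (N : ℕ) :
    b N = ∑ m ∈ range N, binomWeight N (m + 1) * a (m + 1) := by
  induction N with
  | zero => simpa using h0
  | succ N ih =>
    have hN : ((N : ℝ) + 1) ^ 2 ≠ 0 := by positivity
    have hext : b N = ∑ m ∈ range (N + 1), binomWeight N (m + 1) * a (m + 1) := by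
      rw [sum_range_succ, binomWeight_eq_zero (Nat.lt_succ_self N), zero_mul, add_zero, ih]
    refine mul_left_cancel₀ hN ?_
    have := hb N
    rw [mul_sub, sub_eq_iff_eq_add] at this
    rw [this, hext, mul_sum, mul_sum, ← sum_add_distrib]
    refine sum_congr rfl fun m _ => ?_
    have := sq_mul_binomWeight N (m + 1)
    push_cast at this
    linear_combination a (m + 1) * this

/-- Passage to the limit in a weighted sum of a nonnegative convergent series. -/
theorem tendsto_sum_binomWeight_mul {a : ℕ → ℝ} (ha : ∀ m, 0 ≤ a m)
    (hs : Summable fun m => a (m + 1)) :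
    Tendsto (fun N => ∑ m ∈ range N, binomWeight N (m + 1) * a (m + 1)) atTop
      (𝓝 (∑' m, a (m + 1))) := by
  have h : ∀ N, ∑ m ∈ range N, binomWeight N (m + 1) * a (m + 1) =
      ∑' m, binomWeight N (m + 1) * a (m + 1) := fun N =>
    (tsum_eq_sum fun m hm => by
      rw [binomWeight_eq_zero (by rw [mem_range] at hm; omega), zero_mul]).symm
  simp only [h]
  refine tendsto_tsum_of_dominated_convergence hs (fun m => ?_) (Eventually.of_forall fun N m => ?_)
  · simpa using (tendsto_binomWeight (m + 1)).mul_const (a (m + 1))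
  · rw [Real.norm_of_nonneg (mul_nonneg (binomWeight_mem_Icc N _).1 (ha _))]
    exact mul_le_of_le_one_left (ha _) (binomWeight_mem_Icc N _).2

/-! ### Compositions -/

theorem mem_positiveTuples {n w : ℕ} {k : Fin n → ℕ} :
    k ∈ positiveTuples n w ↔ ∑ j, k j = w ∧ ∀ j, 1 ≤ k j := by
  simp [positiveTuples, Finset.Nat.mem_antidiagonalTuple]

theorem positiveTuples_eq_empty {n w : ℕ} (h : w < n) : positiveTuples n w = ∅ := by
  refine eq_empty_of_forall_notMem fun k hk => ?_
  rw [mem_positiveTuples] at hk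
  have := sum_le_sum fun j (_ : j ∈ univ) => hk.2 j
  simp at this
  omega

theorem addToLast_last {i : ℕ} (k : Fin (i + 1) → ℕ) (c : ℕ) :
    addToLast k c (Fin.last i) = k (Fin.last i) + c := by
  simp [addToLast]

theorem addToLast_castSucc {i : ℕ} (k : Fin (i + 1) → ℕ) (c : ℕ) (j : Fin i) :
    addToLast k c j.castSucc = k j.castSucc := by
  simp [addToLast]

theorem init_addToLast {i : ℕ} (k : Fin (i + 1) → ℕ) (c : ℕ) :
    Fin.init (addToLast k c) = Fin.init k :=
  funext fun j => addToLast_castSucc k c j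

theorem starTerm_addToLast {i : ℕ} (k : Fin (i + 1) → ℕ) (c m : ℕ) :
    starTerm (addToLast k c) m = starTerm k m / (m : ℝ) ^ c := by
  rw [starTerm, starTerm, init_addToLast, addToLast_last, pow_add, div_div]

/-- A composition of `w + 1` either ends in `1`, or is a composition of `w` with its last part
increased. -/
theorem sum_positiveTuples_succ {i w : ℕ} (f : (Fin (i + 1) → ℕ) → ℝ) :
    ∑ k ∈ positiveTuples (i + 1) (w + 1), f k =
      ∑ k ∈ positiveTuples i w, f (Fin.snoc k 1) +
        ∑ k ∈ positiveTuples (i + 1) w, f (addToLast k 1) := by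
  rw [← sum_filter_add_sum_filter_not _ (fun k => k (Fin.last i) = 1)]
  congr 1
  · have hsnoc : ∀ k ∈ (positiveTuples (i + 1) (w + 1)).filter (fun k => k (Fin.last i) = 1),
        (Fin.snoc (Fin.init k) 1 : Fin (i + 1) → ℕ) = k := by
      intro k hk
      conv_rhs => rw [← Fin.snoc_init_self k, (mem_filter.1 hk).2]
    refine sum_bij' (fun k _ => Fin.init k) (fun k _ => Fin.snoc k 1) ?_ ?_ ?_ ?_ ?_
    · intro k hk
      simp only [mem_filter, mem_positiveTuples, Fin.sum_univ_castSucc] at hk ⊢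
      exact ⟨by simp only [Fin.init]; omega, fun j => hk.1.2 _⟩
    · intro k hk
      simp only [mem_filter, mem_positiveTuples, Fin.sum_univ_castSucc] at hk ⊢
      refine ⟨⟨by simp [hk.1], fun j => ?_⟩, by simp⟩
      refine Fin.lastCases ?_ (fun j => ?_) j
      · simp
      · simpa using hk.2 j
    · exact hsnoc
    · intro k hk
      simp
    · exact fun k hk => congrArg f (hsnoc k hk).symm
  · have hsub : ∀ k : Fin (i + 1) → ℕ, 1 ≤ k (Fin.last i) →
        addToLast (Function.update k (Fin.last i) (k (Fin.last i) - 1)) 1 = k := by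
      intro k hk
      simp [addToLast, Nat.sub_add_cancel hk]
    refine sum_bij' (fun k _ => Function.update k (Fin.last i) (k (Fin.last i) - 1))
      (fun k _ => addToLast k 1) ?_ ?_ ?_ ?_ ?_
    · intro k hk
      simp only [mem_filter, mem_positiveTuples, Fin.sum_univ_castSucc] at hk ⊢
      have h1 := hk.1.2 (Fin.last i)
      refine ⟨by simp; omega, fun j => ?_⟩
      refine Fin.lastCases ?_ (fun j => ?_) j
      · simp; omega
      · simpa using hk.1.2 j.castSucc
    · intro k hk
      simp only [mem_filter, mem_positiveTuples, Fin.sum_univ_castSucc] at hk ⊢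
      have h1 := hk.2 (Fin.last i)
      refine ⟨⟨by simp only [addToLast_last, addToLast_castSucc]; omega, fun j => ?_⟩, ?_⟩
      · refine Fin.lastCases ?_ (fun j => ?_) j
        · rw [addToLast_last]; omega
        · rw [addToLast_castSucc]; exact hk.2 _
      · rw [addToLast_last]; omega
    · intro k hk
      exact hsub k ((mem_positiveTuples.1 (mem_filter.1 hk).1).2 _)
    · intro k hk
      simp [addToLast]
    · intro k hk
      rw [hsub k ((mem_positiveTuples.1 (mem_filter.1 hk).1).2 _)]

/-! ### Signed sums over compositions -/

/-- The signed sum over the compositions of `w` of the terms of the zeta-star series with largest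
variable `m`. For `m ≥ 1` it is the coefficient of `x ^ w` in
`2x / (m + x) * ∏_{j ≤ m} (j + x) / (j - x)`. -/
noncomputable def signedTerm (m w : ℕ) : ℝ :=
  ∑ i ∈ range w, (-1 : ℝ) ^ (w - 1 - i) * 2 ^ (i + 1) *
    ∑ k ∈ positiveTuples (i + 1) w, starTerm k m

/-- The signed sum over the compositions of `w` of the zeta-star sums truncated at `m`. It is the
coefficient of `x ^ w` in `∏_{j ≤ m} (j + x) / (j - x)`. -/
noncomputable def signedSum (m w : ℕ) : ℝ :=
  ∑ i ∈ range (w + 1), (-1 : ℝ) ^ (w - i) * 2 ^ i * ∑ k ∈ positiveTuples i w, starSum k m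

theorem signedTerm_zero (m : ℕ) : signedTerm m 0 = 0 := by
  simp [signedTerm]

theorem signedSum_zero_left (w : ℕ) : signedSum 0 w = if w = 0 then 1 else 0 := by
  rw [signedSum, sum_range_succ']
  have : ∀ i, ∑ k ∈ positiveTuples (i + 1) w, starSum k 0 = 0 := fun i =>
    sum_eq_zero fun k _ => by simp [starSum]
  simp only [this, mul_zero, sum_const_zero, zero_add]
  cases w with
  | zero =>
    have : positiveTuples 0 0 = {Fin.elim0} := by
      ext k
      simp [mem_positiveTuples, Subsingleton.elim k Fin.elim0]
    simp [this, starSum]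
  | succ w =>
    have : positiveTuples 0 (w + 1) = ∅ :=
      eq_empty_of_forall_notMem fun k hk => by simp [mem_positiveTuples] at hk
    simp [this]

theorem signedSum_succ_left (m w : ℕ) :
    signedSum (m + 1) w = signedSum m w + signedTerm (m + 1) w := by
  rw [signedSum, signedSum, signedTerm, sum_range_succ', sum_range_succ', add_right_comm,
    ← sum_add_distrib]
  congr 1
  refine sum_congr rfl fun i _ => ?_
  rw [show w - 1 - i = w - (i + 1) by omega, ← mul_add, ← sum_add_distrib]
  simp only [starSum_succ, sum_range_succ]

/-- The coefficient form of `(m + x) (P_m - P_{m-1}) = 2x P_m`. -/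
theorem mul_signedTerm_succ (m w : ℕ) (hm : m ≠ 0) :
    (m : ℝ) * signedTerm m (w + 1) + signedTerm m w = 2 * signedSum m w := by
  have hm' : (m : ℝ) ≠ 0 := by exact_mod_cast hm
  -- The additional summand `i = w` vanishes, as there is no composition of `w` into `w + 1` parts.
  have hext : signedTerm m w = ∑ i ∈ range (w + 1), (-1 : ℝ) ^ (w - 1 - i) * 2 ^ (i + 1) *
      ∑ k ∈ positiveTuples (i + 1) w, starTerm k m := by
    rw [sum_range_succ, positiveTuples_eq_empty (Nat.lt_succ_self w), signedTerm]
    simp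
  have hsnoc : ∀ (i : ℕ) (k : Fin i → ℕ),
      starTerm (Fin.snoc k 1 : Fin (i + 1) → ℕ) m = starSum k m / m := by
    intro i k
    simp [starTerm]
  rw [hext, signedTerm, signedSum, mul_sum, mul_sum, ← sum_add_distrib]
  refine sum_congr rfl fun i hi => ?_
  rw [sum_positiveTuples_succ]
  simp only [hsnoc, starTerm_addToLast, pow_one, ← sum_div, Nat.add_sub_cancel]
  rcases (Nat.lt_succ_iff.1 (mem_range.1 hi)).eq_or_lt with rfl | hlt
  · rw [positiveTuples_eq_empty (Nat.lt_succ_self i)]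
    simp
    field_simp
    ring
  · rw [show w - i = (w - 1 - i) + 1 by omega]
    field_simp
    ring

/-- With `P_m = signedSum m`, the summands are the differences in `m` of
`w_N(m) (N - m) P_m(w)`, which vanishes at `m = N` and equals `N` times the coefficient of `x ^ w`
in `1` at `m = 0`. -/
theorem telescoping_signedTerm (N w : ℕ) :
    ∑ m ∈ range N, binomWeight N (m + 1) *
        (((m : ℝ) + 1) ^ 2 * signedTerm (m + 1) (w + 1) - (N : ℝ) * signedTerm (m + 1) w) =
      (N : ℝ) * if w = 0 then 1 else 0 := by
  have h : ∀ m : ℕ, binomWeight N (m + 1) *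
      (((m : ℝ) + 1) ^ 2 * signedTerm (m + 1) (w + 1) - (N : ℝ) * signedTerm (m + 1) w) =
      binomWeight N m * (N - m) * signedSum m w -
        binomWeight N (m + 1) * (N - (m + 1 : ℕ)) * signedSum (m + 1) w := by
    intro m
    have h1 := mul_signedTerm_succ (m + 1) w (Nat.succ_ne_zero m)
    have h2 := signedSum_succ_left m w
    rw [← binomWeight_succ_mul]
    push_cast at h1 ⊢
    rw [show signedSum m w = signedSum (m + 1) w - signedTerm (m + 1) w by rw [h2]; ring]
    linear_combination binomWeight N (m + 1) * ((m : ℝ) + 1) * h1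
  rw [sum_congr rfl fun m _ => h m,
    sum_range_sub' (fun m => binomWeight N m * ((N : ℝ) - (m : ℕ)) * signedSum m w)]
  simp [binomWeight_zero, signedSum_zero_left]

/-! ### The finite identity -/

theorem starSum_ones_succ_succ (w N : ℕ) :
    ((N : ℝ) + 1) * (starSum (fun _ : Fin (w + 1) => 1) (N + 1) -
      starSum (fun _ : Fin (w + 1) => 1) N) = starSum (fun _ : Fin w => 1) (N + 1) := by
  have : (N : ℝ) + 1 ≠ 0 := by positivity
  have hinit : Fin.init (fun _ : Fin (w + 1) => 1) = fun _ : Fin w => 1 := rfl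
  rw [starSum_succ, starSum_succ, sum_range_succ, add_sub_cancel_left, starTerm, hinit]
  push_cast
  field_simp

theorem starSum_ones (w N : ℕ) :
    starSum (fun _ : Fin w => 1) N =
      (if w = 0 then 1 else 0) + ∑ m ∈ range N, binomWeight N (m + 1) * signedTerm (m + 1) w := by
  induction w generalizing N with
  | zero => simp [starSum_zero, signedTerm_zero]
  | succ w ih =>
    rw [if_neg (Nat.succ_ne_zero w), zero_add]
    refine eq_sum_binomWeight_mul (a := fun m => signedTerm m (w + 1)) (by simp [starSum])
      (fun N => ?_) N
    have h := telescoping_signedTerm (N + 1) w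
    simp only [mul_sub, sum_sub_distrib, mul_left_comm _ ((N + 1 : ℕ) : ℝ), ← mul_sum] at h
    rw [sub_eq_iff_eq_add, ← mul_add, ← ih] at h
    rw [h, sq, mul_assoc, starSum_ones_succ_succ]
    push_cast
    ring

theorem onesTwos_succ_last (a b : ℕ) : onesTwos a (b + 1) (Fin.last (a + b)) = 2 := by
  have : (Fin.last (a + b) : Fin (a + (b + 1))) = Fin.natAdd a (Fin.last b) := rfl
  simp only [onesTwos]
  exact (congrArg _ this).trans (Fin.append_right _ _ _)

theorem init_onesTwos_succ (a b : ℕ) :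
    (Fin.init (onesTwos a (b + 1) : Fin (a + b + 1) → ℕ)) = onesTwos a b := by
  funext j
  refine Fin.addCases (fun j => ?_) (fun j => ?_) j
  · exact (Fin.append_left (fun _ : Fin a => 1) (fun _ : Fin (b + 1) => 2) j).trans
      (Fin.append_left (fun _ : Fin a => 1) (fun _ : Fin b => 2) j).symm
  · exact (Fin.append_right (fun _ : Fin a => 1) (fun _ : Fin (b + 1) => 2) j.castSucc).trans
      (Fin.append_right (fun _ : Fin a => 1) (fun _ : Fin b => 2) j).symm

theorem one_le_onesTwos (a b : ℕ) (j : Fin (a + b)) : 1 ≤ onesTwos a b j := by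
  refine Fin.addCases (fun j => ?_) (fun j => ?_) j <;> simp [onesTwos]

theorem onesTwos_zero (a : ℕ) : onesTwos a 0 = fun _ => 1 := by
  funext j
  exact Fin.append_left (fun _ : Fin a => 1) (fun _ : Fin 0 => 2) j

theorem starSum_onesTwos (r b N : ℕ) :
    starSum (onesTwos (r + 1) b) N = ∑ m ∈ range N, binomWeight N (m + 1) *
      (signedTerm (m + 1) (r + 1) / ((m + 1 : ℕ) : ℝ) ^ (2 * b)) := by
  induction b generalizing N with
  | zero =>
    rw [onesTwos_zero]
    simpa using starSum_ones (r + 1) N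
  | succ b ih =>
    have hrec : ∀ N, starSum (onesTwos (r + 1) (b + 1)) N =
        ∑ m ∈ range N, starSum (onesTwos (r + 1) b) (m + 1) / ((m + 1 : ℕ) : ℝ) ^ 2 := by
      intro N
      refine (starSum_succ (n := r + 1 + b) (onesTwos (r + 1) (b + 1)) N).trans
        (sum_congr rfl fun m _ => ?_)
      rw [starTerm, init_onesTwos_succ, onesTwos_succ_last]
    refine eq_sum_binomWeight_mul
      (a := fun m => signedTerm m (r + 1) / ((m : ℕ) : ℝ) ^ (2 * (b + 1)))
      (by rw [hrec]; simp) (fun N => ?_) N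
    have hN : (N : ℝ) + 1 ≠ 0 := by positivity
    rw [hrec, hrec, sum_range_succ, add_sub_cancel_left, ih]
    push_cast
    rw [mul_div_cancel₀ _ (by positivity)]
    refine sum_congr rfl fun m _ => ?_
    have hm : (m : ℝ) + 1 ≠ 0 := by positivity
    rw [mul_add 2 b 1, pow_add]
    field_simp

/-! ### The limit -/

theorem mainTheorem1 (r s : ℕ) (hs : 2 ≤ s) :
    Summable (zetaStarTerm (onesTwos (r + 1) (s - 1))) ∧
    (∀ i ∈ Finset.range (r + 1), ∀ k ∈ positiveTuples (i + 1) (r + 1),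
      Summable (zetaStarTerm (addToLast k (2 * s - 2)))) ∧
    zetaStar (onesTwos (r + 1) (s - 1)) =
      ∑ i ∈ Finset.range (r + 1), (-1 : ℝ) ^ (r - i) * 2 ^ (i + 1) *
        ∑ k ∈ positiveTuples (i + 1) (r + 1), zetaStar (addToLast k (2 * s - 2)) := by
  obtain ⟨b, rfl⟩ := Nat.exists_eq_add_of_le' hs
  rw [show b + 2 - 1 = b + 1 by omega, show 2 * (b + 2) - 2 = 2 * (b + 1) by omega]
  have hone : ∀ j, 1 ≤ (onesTwos (r + 1) (b + 1) : Fin (r + 1 + b + 1) → ℕ) j :=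
    one_le_onesTwos (r + 1) (b + 1)
  have htwo : 2 ≤ onesTwos (r + 1) (b + 1) (Fin.last (r + 1 + b)) :=
    (onesTwos_succ_last (r + 1) b).ge
  have hL := hasSum_zetaStarTerm (n := r + 1 + b) (onesTwos (r + 1) (b + 1)) hone htwo
  have hLlim : Tendsto (fun N => starSum (onesTwos (r + 1) (b + 1)) N) atTop
      (𝓝 (zetaStar (onesTwos (r + 1) (b + 1)))) := by
    have h := (summable_starTerm (n := r + 1 + b) (onesTwos (r + 1) (b + 1)) hone
      htwo).hasSum.tendsto_sum_nat
    rw [← hL.tsum_eq] at h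
    exact h.congr fun N => (starSum_succ (n := r + 1 + b) (onesTwos (r + 1) (b + 1)) N).symm
  have hpos : ∀ i, ∀ k ∈ positiveTuples (i + 1) (r + 1), ∀ j, 1 ≤ addToLast k (2 * (b + 1)) j := by
    intro i k hk j
    have h := (mem_positiveTuples.1 hk).2
    refine Fin.lastCases ?_ (fun j => ?_) j
    · rw [addToLast_last]; omega
    · rw [addToLast_castSucc]; exact h _
  have hlast : ∀ (i : ℕ) (k : Fin (i + 1) → ℕ), 2 ≤ addToLast k (2 * (b + 1)) (Fin.last i) := by
    intro i k
    rw [addToLast_last]; omega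
  refine ⟨hL.summable,
    fun i _ k hk => (hasSum_zetaStarTerm _ (hpos i k hk) (hlast i k)).summable, ?_⟩
  refine tendsto_nhds_unique hLlim ?_
  have hR : Tendsto (fun N => ∑ i ∈ range (r + 1), (-1 : ℝ) ^ (r - i) * 2 ^ (i + 1) *
      ∑ k ∈ positiveTuples (i + 1) (r + 1), ∑ m ∈ range N, binomWeight N (m + 1) *
        starTerm (addToLast k (2 * (b + 1))) (m + 1)) atTop
      (𝓝 (∑ i ∈ range (r + 1), (-1 : ℝ) ^ (r - i) * 2 ^ (i + 1) *
        ∑ k ∈ positiveTuples (i + 1) (r + 1), zetaStar (addToLast k (2 * (b + 1))))) := by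
    refine tendsto_finsetSum _ fun i _ => (tendsto_finsetSum _ fun k hk => ?_).const_mul _
    rw [zetaStar, (hasSum_zetaStarTerm _ (hpos i k hk) (hlast i k)).tsum_eq]
    exact tendsto_sum_binomWeight_mul (fun m => starTerm_nonneg _ m)
      (summable_starTerm _ (hpos i k hk) (hlast i k))
  refine hR.congr fun N => ?_
  rw [starSum_onesTwos]
  simp only [starTerm_addToLast, signedTerm, sum_div, mul_sum, Nat.add_sub_cancel]
  rw [sum_comm' (s := range N) (t' := range (r + 1)) (s' := fun _ => range N) (by simp [and_comm])]
  refine sum_congr rfl fun i _ => ?_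
  rw [sum_comm]
  exact sum_congr rfl fun m _ => sum_congr rfl fun k _ => by ring
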